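/- **Setting.** Let $X$ be a normal noetherian integral scheme over $\mathbb C$ (for instance a minimal model of a quotient singularity $V/G$, $G\subset SL(V)$ finite) whose divisor class group $\mathrm{Cl}(X)$ is free of finite rank, and let $D_1,\dots,D_m$ be Weil divisors whose classes form a $\mathbb Z$-basis of $\mathrm{Cl}(X)$. Put $$\mathrm{Cox}(X)=\bigoplus_{a\in\mathbb Z^m}H^0\bigl(X,\mathcal O_X(a_1D_1+\dots+a_mD_m)\bigr),\qquad \mathfrak X=\mathrm{Spec}\,\mathrm{Cox}(X),$$ where $H^0(X,\mathcal O_X(D))=\{f\in\mathbb C(X)^*\mid \mathrm{div}(f)+D\ge 0\}\cup\{0\}$ and multiplication is that of $\mathbb C(X)$. Let $\mathrm{Cl}(X)_{\mathbb R}=\mathrm{Cl}(X)\otimes\mathbb R$, so that $m=\dim_{\mathbb R}\mathrm{Cl}(X)_{\mathbb R}$. The torus $T=\mathrm{Hom}(\mathrm{Cl}(X),\mathbb C^*)$ acts on the degree-$D$ part of $\mathrm{Cox}(X)$ by multiplication by $t(D)$; for $D\in\mathrm{Cl}(X)$ let $R(D)=\{f\in \mathrm{Cox}(X)\mid t\cdot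 f=t(D)f\ \ \forall t\in T\}$. A point $x\in\mathfrak X$ is *$D$-semistable* if $f(x)\neq0$ for some $f\in R(iD)$ and some integer $i>0$; $\mathfrak X_D^{ss}$ is the set of such points. Two classes in $\mathrm{Cl}(X)$ are *GIT equivalent* if they have the same semistable locus. Only classes with non-empty semistable locus are considered below. A GIT equivalence class is viewed in $\mathrm{Cl}(X)_{\mathbb R}$ as the union of the rays $\mathbb R_{>0}D$ through its members $D$; it is a *GIT chamber* if it is not contained in a hyperplane. The *GIT fan* is the fan whose maximal cones are the closures of the GIT chambers; its cones are the closures of the GIT equivalence classes. Let $S\subset\mathrm{Cox}(X)$ be a finite set of nonzero homogeneous elements generating $\mathrm{Cox}(X)$ as a $\mathbb C$-algebra. For $S'\subset S$ let $\mathrm{cone}(S')\subset\mathrm{Cl}(X)_{\mathbb R}$ be the convex cone generated by the degrees of the elements of $S'$, and let $\mathcal Z(S')\subset\mathfrak X$ be the zero locus of the product $\prod_{\psi\in S'}\psi$. Let $\mathcal F(S)$ be the coarsest fan (of strongly convex rational polyhedral cones) in $\mathrm{Cl}(X)_{\mathbb R}$ with support $\mathrm{cone}(S)$ such that each $\mathrm{cone}(S')$,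 $S'\subset S$, is a union of cones of the fan. A *chamber* of $\mathcal F(S)$ is the interior of a full-dimensional cone of $\mathcal F(S)$. **Proposition.** Let $C$ be a chamber of $\mathcal F(S)$. Then for every integral class $D\in\mathrm{Cl}(X)$ lying in $C$, $$\mathfrak X\setminus\mathfrak X_D^{ss}=\bigcap_{\substack{S'\subset S,\ |S'|=m\\ D\in\mathrm{cone}(S')}}\mathcal Z(S').$$ In particular, $\mathcal F(S)$ is a refinement of the GIT fan: every cone of $\mathcal F(S)$ is contained in the closure of a GIT chamber, and the closure of every GIT equivalence class (with non-empty semistable locus) is a union of cones of $\mathcal F(S)$. -/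

import Mathlib

open AlgebraicGeometry CategoryTheory TensorProduct Topology

noncomputable section

namespace CoxGIT

/-! ### Weil divisors on a normal noetherian integral scheme over `ℂ` -/

/-- A scheme is normal if all its local rings are integrally closed. -/
class IsNormalScheme (X : Scheme.{0}) : Prop where
  stalk_isIntegrallyClosed : ∀ x : X, IsIntegrallyClosed (X.presheaf.stalk x)

/-- Prime divisors of `X`, represented by their generic points: the points of codimension one. -/
def PrimeDivisor (X : Scheme.{0}) : Type := {x : X // Order.coheight x = 1}

/-- Weil divisors on a noetherian scheme: finite integral combinations of prime divisors. -/
abbrev WDiv (X : Scheme.{0}) : Type := PrimeDivisor X →₀ ℤ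

section Divisors

variable (X : Scheme.{0}) [IsIntegral X] [IsNoetherian X]

/-- The subgroup of principal divisors `div(f)`, `f` a nonzero rational function. -/
def principalDivisors : AddSubgroup (WDiv X) where
  carrier := {D | ∃ f : X.functionField, f ≠ 0 ∧ ∀ E : PrimeDivisor X, D E = Scheme.ord f E.1}
  zero_mem' := by
    refine ⟨1, one_ne_zero, fun E => ?_⟩
    have h := Scheme.ord_mul (X := X) (x := E.1) (one_ne_zero (α := X.functionField)) one_ne_zero
    rw [mul_one] at h
    simp only [Finsupp.coe_zero, Pi.zero_apply]
    lia
  add_mem' := by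
    rintro D D' ⟨f, hf, hD⟩ ⟨g, hg, hD'⟩
    refine ⟨f * g, mul_ne_zero hf hg, fun E => ?_⟩
    rw [Scheme.ord_mul hf hg, Finsupp.add_apply, hD, hD']
  neg_mem' := by
    rintro D ⟨f, hf, hD⟩
    refine ⟨f⁻¹, inv_ne_zero hf, fun E => ?_⟩
    have h := Scheme.ord_mul (X := X) (x := E.1) hf (inv_ne_zero hf)
    have h1 := Scheme.ord_mul (X := X) (x := E.1) (one_ne_zero (α := X.functionField)) one_ne_zero
    rw [mul_inv_cancel₀ hf] at h
    rw [mul_one] at h1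
    rw [Finsupp.neg_apply, hD]
    lia

/-- The divisor class group `Cl(X)`. -/
abbrev Cl : Type := WDiv X ⧸ principalDivisors X

variable {X}

/-- The class of a Weil divisor in `Cl(X)`. -/
def cl (D : WDiv X) : Cl X := QuotientAddGroup.mk D

lemma isDVR_stalk [IsNormalScheme X] (E : PrimeDivisor X) :
    IsDiscreteValuationRing (X.presheaf.stalk E.1) := by
  have hd : Ring.KrullDimLE 1 (X.presheaf.stalk E.1) := krullDimLE_of_coheight_le E.2.le
  have hi : IsIntegrallyClosed (X.presheaf.stalk E.1) :=
    IsNormalScheme.stalk_isIntegrallyClosed E.1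
  have hnf : ¬ IsField (X.presheaf.stalk E.1) := by
    intro h
    have h0 := ringKrullDim_eq_zero_of_isField h
    rw [ringKrullDim_stalk_eq_coheight, E.2] at h0
    exact absurd h0 (by norm_num)
  have hded : IsDedekindDomain (X.presheaf.stalk E.1) :=
    { hi with
      toIsDomain := inferInstance
      toIsNoetherian := inferInstance
      maximalOfPrime := fun {P} hP hPp => by
        exact Ideal.IsPrime.isMaximal_of_ne_bot hPp hP }
  exact ((IsDiscreteValuationRing.TFAE _ hnf).out 0 2).mpr hded

variable [X.Over (Spec (CommRingCat.of ℂ))]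

/-- The function field of a `ℂ`-scheme is a `ℂ`-algebra through the structure morphism. -/
instance : Algebra ℂ X.functionField :=
  ((X.presheaf.germ ⊤ (genericPoint X) trivial).hom.comp
    ((X ↘ Spec (CommRingCat.of ℂ)).appTop.hom.comp
      (Scheme.ΓSpecIso (CommRingCat.of ℂ)).inv.hom)).toAlgebra

lemma ord_algebraMap {c : ℂ} (hc : c ≠ 0) (x : X) :
    Scheme.ord (algebraMap ℂ X.functionField c) x = 0 := by
  have hu : IsUnit (((X ↘ Spec (CommRingCat.of ℂ)).appTop.hom.comp
      (Scheme.ΓSpecIso (CommRingCat.of ℂ)).inv.hom) c) := (IsUnit.mk0 c hc).map _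
  have hn : Nonempty (⊤ : X.Opens) := ⟨⟨x, trivial⟩⟩
  exact Scheme.ord_of_isUnit (U := ⊤) hu trivial

variable [IsNormalScheme X]

/-- `H⁰(X, 𝒪_X(D)) = {f ≠ 0 | div(f) + D ≥ 0} ∪ {0}`. -/
def H0 (D : WDiv X) : Submodule ℂ X.functionField where
  carrier := {f | f ≠ 0 → ∀ E : PrimeDivisor X, 0 ≤ Scheme.ord f E.1 + D E}
  zero_mem' := fun h => absurd rfl h
  add_mem' := by
    intro f g hf hg hfg E
    have := isDVR_stalk E
    by_cases h0 : f = 0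
    · subst h0; rw [zero_add] at hfg ⊢; exact hg hfg E
    by_cases h1 : g = 0
    · subst h1; rw [add_zero] at hfg ⊢; exact hf hfg E
    have h := Scheme.ord_add (x := E.1) hfg
    have := hf h0 E
    have := hg h1 E
    omega
  smul_mem' := by
    intro c f hf hcf E
    rw [Algebra.smul_def] at hcf ⊢
    have hc : c ≠ 0 := by rintro rfl; simp at hcf
    have hf0 : f ≠ 0 := right_ne_zero_of_mul hcf
    rw [Scheme.ord_mul (left_ne_zero_of_mul hcf) hf0, ord_algebraMap hc, zero_add]
    exact hf hf0 E

lemma mul_mem_H0 {D D' : WDiv X} {f g : X.functionField} (hf : f ∈ H0 D) (hg : g ∈ H0 D') :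
    f * g ∈ H0 (D + D') := by
  intro hfg E
  have hf0 := left_ne_zero_of_mul hfg
  have hg0 := right_ne_zero_of_mul hfg
  rw [Scheme.ord_mul hf0 hg0, Finsupp.add_apply]
  have := hf hf0 E
  have := hg hg0 E
  lia

end Divisors

/-! ### The Cox ring, the torus action and semistability -/

/-- The Weil divisors `D₁, …, D_r` represent a `ℤ`-basis of `Cl(X)`. -/
def IsClassBasis {X : Scheme.{0}} [IsIntegral X] [IsNoetherian X] {r : ℕ}
    (D : Fin r → WDiv X) : Prop :=
  LinearIndependent ℤ (fun i => cl (D i)) ∧ Submodule.span ℤ (Set.range fun i => cl (D i)) = ⊤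

/-- The divisor `a₁D₁ + ⋯ + a_rD_r`. -/
def combo {X : Scheme.{0}} {r : ℕ} (D : Fin r → WDiv X) (a : Fin r → ℤ) : WDiv X := ∑ i, a i • D i

lemma combo_add {X : Scheme.{0}} {r : ℕ} (D : Fin r → WDiv X) (a b : Fin r → ℤ) :
    combo D (a + b) = combo D a + combo D b := by
  simp [combo, add_smul, Finset.sum_add_distrib]

section Cox

variable {X : Scheme.{0}} [IsIntegral X] [IsNoetherian X] [IsNormalScheme X]
  [X.Over (Spec (CommRingCat.of ℂ))] {r : ℕ}

/-- `Cox(X) = ⨁_{a ∈ ℤ^r} H⁰(X, 𝒪_X(a₁D₁ + ⋯ + a_rD_r))` with the multiplication of `ℂ(X)`,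
realized as the subalgebra of the group algebra `ℂ(X)[ℤ^r]` of those elements whose coefficient at
each `a` lies in `H⁰(X, 𝒪_X(a₁D₁ + ⋯ + a_rD_r))`. -/
def Cox (D : Fin r → WDiv X) : Subalgebra ℂ (AddMonoidAlgebra X.functionField (Fin r → ℤ)) where
  carrier := {f | ∀ a, f.coeff a ∈ H0 (combo D a)}
  add_mem' := by
    intro f g hf hg a
    simpa using (H0 (combo D a)).add_mem (hf a) (hg a)
  mul_mem' := by
    intro f g hf hg a
    classical
    rw [AddMonoidAlgebra.coeff_mul]
    refine Submodule.sum_mem _ fun b _ => Submodule.sum_mem _ fun c _ => ?_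
    show (if b + c = a then f.coeff b * g.coeff c else 0) ∈ _
    split_ifs with h
    · rw [← h, combo_add]
      exact mul_mem_H0 (hf b) (hg c)
    · exact zero_mem _
  algebraMap_mem' := by
    intro c a
    rw [AddMonoidAlgebra.coe_algebraMap, Function.comp_apply, AddMonoidAlgebra.coeff_single,
      Finsupp.single_apply]
    split_ifs with h
    · subst h
      intro h0 E
      have hc : c ≠ 0 := by rintro rfl; simp at h0
      rw [ord_algebraMap hc]
      simp [combo]
    · exact zero_mem _

variable (D : Fin r → WDiv X)

/-- The algebraic torus `T = Hom(Cl(X), ℂ^*)`. -/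
abbrev Torus (X : Scheme.{0}) [IsIntegral X] [IsNoetherian X] : Type :=
  Multiplicative (Cl X) →* ℂˣ

/-- The value `t(c)` of `t ∈ T` at a class `c`: this is also the character of `T` given by `c`. -/
def charEval (c : Cl X) (t : Torus X) : ℂ := (t (Multiplicative.ofAdd c) : ℂ)

/-- The action of `t ∈ T` on `Cox(X)`: it multiplies the part of degree `[a₁D₁ + ⋯ + a_rD_r]` by
the scalar `t([a₁D₁ + ⋯ + a_rD_r])`. -/
def torusAct (t : Torus X) (f : Cox D) : Cox D :=
  ⟨.ofCoeff (Finsupp.onFinset f.1.coeff.support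
      (fun a => charEval (cl (combo D a)) t • f.1.coeff a)
      (fun a h => by
        rw [Finsupp.mem_support_iff]
        intro h0
        exact h (by rw [h0, smul_zero]))),
    fun a => (H0 (combo D a)).smul_mem _ (f.2 a)⟩

/-- `R(c) = {f | t · f = c(t) f for all t ∈ T}`, the semi-invariant functions on `Spec Cox(X)` for
the character `c`, i.e. the homogeneous part of `Cox(X)` of degree `c`. -/
def homogeneousPart (c : Cl X) : Set (Cox D) :=
  {f | ∀ t : Torus X, torusAct D t f = charEval c t • f}

/-- The underlying space of `𝔛 = Spec Cox(X)`. -/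
abbrev SpecCox : Type := PrimeSpectrum (Cox D)

/-- The `c`-semistable locus: the points `x` with `f(x) ≠ 0` for some `i > 0` and `f ∈ R(ic)`. -/
def semistable (c : Cl X) : Set (SpecCox D) :=
  {x | ∃ i : ℕ, 0 < i ∧ ∃ f ∈ homogeneousPart D (i • c), f ∉ x.asIdeal}

end Cox

/-! ### The real class space, cones and fans -/

/-- `Cl(X)_ℝ = Cl(X) ⊗ ℝ`. -/
def ClR (X : Scheme.{0}) [IsIntegral X] [IsNoetherian X] : Type := ℝ ⊗[ℤ] Cl X

section Fans

variable {X : Scheme.{0}} [IsIntegral X] [IsNoetherian X]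

instance : AddCommGroup (ClR X) := inferInstanceAs (AddCommGroup (ℝ ⊗[ℤ] Cl X))

instance : Module ℝ (ClR X) := inferInstanceAs (Module ℝ (ℝ ⊗[ℤ] Cl X))

/-- The canonical real vector space topology; when `Cl(X)_ℝ` is finite dimensional this is the
usual Euclidean topology. -/
instance : TopologicalSpace (ClR X) := moduleTopology ℝ (ClR X)

/-- The image in `Cl(X)_ℝ` of an integral class. -/
def toReal (c : Cl X) : ClR X := (1 : ℝ) ⊗ₜ[ℤ] c

/-- A fan in `Cl(X)_ℝ`: a finite set of strongly convex rational polyhedral cones that is closed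
under taking faces and in which two cones always intersect in a common face. -/
structure IsFan (F : Set (PointedCone ℝ (ClR X))) : Prop where
  finite : F.Finite
  rational : ∀ σ ∈ F, ∃ s : Finset (Cl X), σ = PointedCone.hull ℝ (toReal '' (s : Set (Cl X)))
  stronglyConvex : ∀ σ ∈ F, ∀ v ∈ σ, -v ∈ σ → v = 0
  face_mem : ∀ σ ∈ F, ∀ τ : PointedCone ℝ (ClR X), τ.IsFaceOf σ → τ ∈ F
  inter_isFaceOf : ∀ σ ∈ F, ∀ τ ∈ F, (σ ⊓ τ).IsFaceOf σ

/-- The set `A` is subdivided by the cones of `F`, i.e. it is a union of cones belonging to `F`. -/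
def IsUnionOfCones (F : Set (PointedCone ℝ (ClR X))) (A : Set (ClR X)) : Prop :=
  ∃ G ⊆ F, A = ⋃ σ ∈ G, (σ : Set (ClR X))

/-- A chamber of a fan: the interior of one of its full-dimensional cones. -/
def IsChamber (F : Set (PointedCone ℝ (ClR X))) (C : Set (ClR X)) : Prop :=
  C.Nonempty ∧ ∃ σ ∈ F, C = interior (σ : Set (ClR X))

end Fans

/-! ### The fan of a generating system and the GIT fan -/

section GIT

variable {X : Scheme.{0}} [IsIntegral X] [IsNoetherian X] [IsNormalScheme X]
  [X.Over (Spec (CommRingCat.of ℂ))] {r : ℕ} {D : Fin r → WDiv X}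

/-- A homogeneous element of `Cox(X)`; it is required to be nonzero so that it has a degree. -/
def IsHomogeneousElt (ψ : Cox D) : Prop := ψ ≠ 0 ∧ ∃ c : Cl X, ψ ∈ homogeneousPart D c

open Classical in
/-- The degree in `Cl(X)` of a homogeneous element (and `0` for other elements). -/
def deg (ψ : Cox D) : Cl X :=
  if h : ∃ c : Cl X, ψ ∈ homogeneousPart D c then h.choose else 0

/-- `S` is a system of homogeneous generators of the `ℂ`-algebra `Cox(X)`. -/
def IsHomogeneousGenerating (S : Finset (Cox D)) : Prop :=
  (∀ ψ ∈ S, IsHomogeneousElt ψ) ∧ Algebra.adjoin ℂ (S : Set (Cox D)) = ⊤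

/-- `cone(S)`, the cone in `Cl(X)_ℝ` generated by the degrees of the elements of `S`. -/
def cone (S : Finset (Cox D)) : PointedCone ℝ (ClR X) :=
  PointedCone.hull ℝ ((fun ψ => toReal (deg ψ)) '' (S : Set (Cox D)))

/-- `F` is a fan with support `cone(S)` whose cones subdivide every cone `cone(S')`, `S' ⊆ S`. -/
structure SubdividesCones (S : Finset (Cox D)) (F : Set (PointedCone ℝ (ClR X))) : Prop where
  isFan : IsFan F
  support : ⋃ σ ∈ F, (σ : Set (ClR X)) = cone S
  subdivides : ∀ S' ⊆ S, IsUnionOfCones F (cone S')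

/-- `F = 𝓕(S)`: the coarsest fan whose cones subdivide all the cones `cone(S')`, `S' ⊆ S`.
Being coarsest, it is unique; its cones are the intersections
`⋂ {cone(S') | S' ⊆ S, v ∈ cone(S')}` for `v ∈ cone(S)`. -/
structure IsCoarsestFan (S : Finset (Cox D)) (F : Set (PointedCone ℝ (ClR X))) : Prop where
  subdividesCones : SubdividesCones S F
  coarsest : ∀ F' : Set (PointedCone ℝ (ClR X)), SubdividesCones S F' → ∀ τ ∈ F', ∃ σ ∈ F, τ ≤ σ

/-- `𝓩(S') ⊆ 𝔛`, the zero locus of the product of the elements of `S'`. -/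
def zeroLocusProd (S' : Finset (Cox D)) : Set (SpecCox D) :=
  PrimeSpectrum.zeroLocus {∏ ψ ∈ S', ψ}

variable (D)

/-- The GIT equivalence class of `c` in `Cl(X)_ℝ`: the rays through all integral classes with the
same semistable locus as `c`. -/
def gitClass (c : Cl X) : Set (ClR X) :=
  {v | ∃ c' : Cl X, semistable D c' = semistable D c ∧ ∃ t : ℝ, 0 < t ∧ v = t • toReal c'}

/-- The GIT equivalence classes that have a nonempty semistable locus. -/
def IsGITClass (C : Set (ClR X)) : Prop :=
  ∃ c : Cl X, (semistable D c).Nonempty ∧ C = gitClass D c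

/-- A GIT chamber: a GIT equivalence class that is not contained in a hyperplane. -/
def IsGITChamber (C : Set (ClR X)) : Prop :=
  IsGITClass D C ∧ Submodule.span ℝ C = ⊤

/-- The fan `F` is a refinement of the GIT fan, the fan given by the closures of the GIT chambers
(its lower-dimensional cones are the closures of the other GIT classes): every cone of `F` is
contained in the closure of a GIT chamber, and the closure of every GIT class is a union of cones
of `F`. -/
def RefinesGITFan (F : Set (PointedCone ℝ (ClR X))) : Prop :=
  (∀ σ ∈ F, ∃ C, IsGITChamber D C ∧ (σ : Set (ClR X)) ⊆ closure C) ∧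
    ∀ C, IsGITClass D C → IsUnionOfCones F (closure C)

end GIT

end CoxGIT

end

open CoxGIT

noncomputable section

namespace CoxGIT


/-! ### Finitely generated convex cones -/

section Cones

variable {V ι : Type*} [AddCommGroup V] [Module ℝ V]

/-! For a point `x` of `𝔛` let `S_x` be the set of those generators in `S` that do not vanish at
`x`. Each element of `R(ic)` is a combination of monomials of degree `ic` in `S`, so `x` is
`c`-semistable exactly if some positive multiple of `c` is a sum of degrees from `S_x`. Real cone
relations between integral classes can be made integral, so this says `c ∈ cone(S_x)`
(`mem_semistable_iff`). Everything else is convex geometry.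

Formula: let `c` be interior to `σ` and `c ∈ cone(S_x)`. By Carathéodory `c ∈ cone(u)` for some `u ⊆
S_x` with independent degrees. As a union of cones of the fan, `cone(u)` contains all of `σ`, so `u`
spans and has `m` elements. It is then one of the sets `S'`, and its product does not vanish at `x`.
Conversely, an `S'` whose product is nonzero at `x` lies in `S_x`.

Refinement: each `cone(S_x)` is a union of cones of the fan, so the semistable locus is constant on
relative interiors (`semistable_eq`). Rational rays are dense in each cone, so the closure of a GIT
class is the union of the cones whose relative interior it meets. Every cone lies in a
full-dimensional one since the support is convex and spans; the latter holds because classes of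
prime divisors are effective. Relative interiors enter only through faces, as `MemRelint`. -/

lemma mem_hull_image_iff {v : ι → V} {t : Finset ι} {x : V} :
    x ∈ PointedCone.hull ℝ (v '' (t : Set ι)) ↔
      ∃ a : ι → ℝ, (∀ i, 0 ≤ a i) ∧ ∑ i ∈ t, a i • v i = x := by
  rw [PointedCone.hull, Submodule.mem_span_image_finset_iff_exists_fun']
  constructor
  · rintro ⟨c, rfl⟩
    exact ⟨fun i => c i, fun i => (c i).2, rfl⟩
  · rintro ⟨a, ha, rfl⟩
    exact ⟨fun i => ⟨a i, ha i⟩, rfl⟩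

/-- Carathéodory's theorem for convex cones. -/
theorem exists_linearIndepOn_mem_hull {v : ι → V} (t : Finset ι) {x : V}
    (hx : x ∈ PointedCone.hull ℝ (v '' (t : Set ι))) :
    ∃ u ⊆ t, LinearIndepOn ℝ v (u : Set ι) ∧ x ∈ PointedCone.hull ℝ (v '' (u : Set ι)) := by
  classical
  induction t using Finset.strongInduction with
  | H t ih =>
  by_cases hli : LinearIndepOn ℝ v (t : Set ι)
  · exact ⟨t, subset_rfl, hli, hx⟩
  obtain ⟨a, ha, rfl⟩ := mem_hull_image_iff.mp hx
  obtain ⟨g, hg, hpos⟩ : ∃ g : ι → ℝ, ∑ i ∈ t, g i • v i = 0 ∧ ∃ i ∈ t, 0 < g i := by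
    obtain ⟨g, hg, i, hi, hgi⟩ := not_linearIndepOn_finset_iff.mp hli
    rcases lt_or_gt_of_ne hgi with h | h
    · exact ⟨-g, by simp [hg], i, hi, by simpa using h⟩
    · exact ⟨g, hg, i, hi, h⟩
  -- The smallest ratio `a i / g i` is the largest multiple of the relation `g` that can be
  -- subtracted with all coefficients staying nonnegative; it kills the coefficient at `j`.
  obtain ⟨j, hj, hmin⟩ := (t.filter fun i => 0 < g i).exists_min_image (fun i => a i / g i)
    (by obtain ⟨i, hi, h⟩ := hpos; exact ⟨i, Finset.mem_filter.mpr ⟨hi, h⟩⟩)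
  obtain ⟨hjt, hgj⟩ := Finset.mem_filter.mp hj
  have hq : 0 ≤ a j / g j := div_nonneg (ha j) hgj.le
  have hb : ∀ i ∈ t, 0 ≤ a i - a j / g j * g i := by
    intro i hi
    rcases le_or_gt (g i) 0 with h | h
    · nlinarith [ha i, mul_nonneg hq (neg_nonneg.mpr h)]
    · have := (le_div_iff₀ h).mp (hmin i (Finset.mem_filter.mpr ⟨hi, h⟩))
      linarith
  have hsum : ∑ i ∈ t.erase j, (a i - a j / g j * g i) • v i = ∑ i ∈ t, a i • v i := by
    rw [Finset.sum_erase _ (by rw [div_mul_cancel₀ _ hgj.ne', sub_self, zero_smul])]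
    simp_rw [sub_smul, mul_smul]
    rw [Finset.sum_sub_distrib, ← Finset.smul_sum, hg, smul_zero, sub_zero]
  obtain ⟨u, hu, hli', hmem⟩ := ih (t.erase j) (Finset.erase_ssubset hjt) (by
    -- The `max` only serves indices outside `t`, where nothing is known about the sign.
    refine mem_hull_image_iff.mpr ⟨fun i => max (a i - a j / g j * g i) 0,
      fun i => le_max_right _ _, ?_⟩
    rw [← hsum]
    refine Finset.sum_congr rfl fun i hi => ?_
    beta_reduce
    rw [max_eq_left (hb i (Finset.mem_of_mem_erase hi))])
  exact ⟨u, hu.trans (Finset.erase_subset _ _), hli', hmem⟩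

/-- The point `v` of the cone `τ` lies on no proper face of `τ`. -/
def MemRelint (τ : PointedCone ℝ V) (v : V) : Prop :=
  v ∈ τ ∧ ∀ ρ : PointedCone ℝ V, ρ.IsFaceOf τ → v ∈ ρ → ρ = τ

/-- A face that contains a sum of elements of the cone with positive weights contains every summand,
hence here all the generators. -/
lemma memRelint_hull_of_sum {v : ι → V} {t : Finset ι} {a : ι → ℝ} (ha : ∀ i ∈ t, 0 < a i) :
    MemRelint (PointedCone.hull ℝ (v '' (t : Set ι))) (∑ i ∈ t, a i • v i) := by
  have hmem : ∀ i ∈ t, v i ∈ PointedCone.hull ℝ (v '' (t : Set ι)) := fun i hi =>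
    PointedCone.subset_hull ⟨i, hi, rfl⟩
  refine ⟨Submodule.sum_mem _ fun i hi => PointedCone.smul_mem _ (ha i hi).le (hmem i hi), ?_⟩
  intro ρ hρ h
  refine le_antisymm hρ.le (Submodule.span_le.mpr ?_)
  rintro _ ⟨i, hi, rfl⟩
  rw [← Finset.sum_coe_sort] at h
  exact hρ.mem_of_sum_smul_mem (fun i : t => hmem i i.2) (fun i : t => (ha i i.2).le) h ⟨i, hi⟩
    (ha i hi)

/-- Finitely many proper subspaces miss some `x = p - q` with `p, q ∈ σ`. The points `p + n q` stay
in `σ`, and two of them in one `U` would put `p`, `q` and so `x` into `U`; hence some `n` avoids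
every `U`. -/
lemma exists_mem_forall_notMem_of_span_eq_top (σ : PointedCone ℝ V)
    (hσ : Submodule.span ℝ (σ : Set V) = ⊤) (W : Finset (Submodule ℝ V)) (hW : ⊤ ∉ W) :
    ∃ w ∈ σ, ∀ U ∈ W, w ∉ U := by
  have hdiff : ∀ x : V, ∃ p ∈ σ, ∃ q ∈ σ, x = p - q := by
    intro x
    have hx : x ∈ Submodule.span ℝ (σ : Set V) := hσ ▸ Submodule.mem_top
    induction hx using Submodule.span_induction with
    | mem x hx => exact ⟨x, hx, 0, zero_mem _, (sub_zero x).symm⟩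
    | zero => exact ⟨0, zero_mem _, 0, zero_mem _, (sub_zero 0).symm⟩
    | add x y _ _ hx hy =>
      obtain ⟨p, hp, q, hq, rfl⟩ := hx
      obtain ⟨p', hp', q', hq', rfl⟩ := hy
      exact ⟨p + p', add_mem hp hp', q + q', add_mem hq hq', by abel⟩
    | smul a x _ hx =>
      obtain ⟨p, hp, q, hq, rfl⟩ := hx
      rcases le_total 0 a with h | h
      · exact ⟨a • p, σ.smul_mem h hp, a • q, σ.smul_mem h hq, smul_sub a p q⟩
      · refine ⟨(-a) • q, σ.smul_mem (neg_nonneg.mpr h) hq, (-a) • p,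
          σ.smul_mem (neg_nonneg.mpr h) hp, ?_⟩
        rw [smul_sub, neg_smul, neg_smul]; abel
  obtain ⟨x, hx⟩ : ∃ x, ∀ U ∈ W, x ∉ U := by
    have h := Subspace.biUnion_ne_univ_of_top_notMem hW
    obtain ⟨x, hx⟩ := (Set.ne_univ_iff_exists_notMem _).mp h
    exact ⟨x, fun U hU hxU => hx (Set.mem_biUnion hU hxU)⟩
  obtain ⟨p, hp, q, hq, rfl⟩ := hdiff x
  have hfin : (⋃ U ∈ W, {n : ℕ | p + (n : ℝ) • q ∈ U}).Finite := by
    refine Set.Finite.biUnion W.finite_toSet fun U hU => Set.Subsingleton.finite ?_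
    intro m hm n hn
    by_contra hmn
    have h1 : ((m : ℝ) - n) • q ∈ U := by
      have := U.sub_mem hm hn
      rwa [add_sub_add_left_eq_sub, ← sub_smul] at this
    have hq' : q ∈ U := (U.smul_mem_iff (sub_ne_zero.mpr (Nat.cast_injective.ne hmn))).mp h1
    have hp' : p ∈ U := (U.add_mem_iff_left (U.smul_mem _ hq')).mp hm
    exact hx U hU (U.sub_mem hp' hq')
  obtain ⟨n, hn⟩ := hfin.exists_notMem
  refine ⟨p + (n : ℝ) • q, add_mem hp (σ.smul_mem n.cast_nonneg hq), fun U hU h => hn ?_⟩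
  exact Set.mem_biUnion (x := U) hU h

end Cones

/-! ### Closedness and interior points of cones -/

section TopologicalCones

variable {V ι : Type*} [AddCommGroup V] [Module ℝ V] [TopologicalSpace V]
  [IsTopologicalAddGroup V] [ContinuousSMul ℝ V]

/-- A cone on independent vectors is the image of a closed orthant under a closed embedding; by
Carathéodory any finitely generated cone is a finite union of such cones. -/
theorem isClosed_hull_image [T2Space V] (v : ι → V) (t : Finset ι) :
    IsClosed (PointedCone.hull ℝ (v '' (t : Set ι)) : Set V) := by
  classical
  have hu : ∀ u : Finset ι, LinearIndepOn ℝ v (u : Set ι) →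
      IsClosed (PointedCone.hull ℝ (v '' (u : Set ι)) : Set V) := by
    intro u hu
    have hemb := LinearMap.isClosedEmbedding_of_injective
      (f := Fintype.linearCombination ℝ (fun i : u => v i))
      (LinearMap.ker_eq_bot.mpr
        (LinearIndependent.fintypeLinearCombination_injective hu))
    convert hemb.isClosedMap _ (isClosed_Ici (a := (0 : u → ℝ))) using 1
    ext x
    rw [SetLike.mem_coe, mem_hull_image_iff]
    constructor
    · rintro ⟨a, ha, rfl⟩
      refine ⟨fun i => a i, fun i => ha i, ?_⟩
      rw [Fintype.linearCombination_apply, ← Finset.sum_coe_sort u]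
    · rintro ⟨a, ha, rfl⟩
      refine ⟨fun i => if h : i ∈ u then a ⟨i, h⟩ else 0, fun i => ?_, ?_⟩
      · beta_reduce
        split_ifs
        · exact ha _
        · exact le_rfl
      · rw [Fintype.linearCombination_apply, ← Finset.sum_coe_sort u]
        simp
  have : (PointedCone.hull ℝ (v '' (t : Set ι)) : Set V) =
      ⋃ u ∈ t.powerset.filter fun u : Finset ι => LinearIndepOn ℝ v (u : Set ι),
        (PointedCone.hull ℝ (v '' (u : Set ι)) : Set V) := by
    ext x
    simp only [Set.mem_iUnion, Finset.mem_filter, Finset.mem_powerset, exists_prop]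
    constructor
    · intro hx
      obtain ⟨u, h1, h2, h3⟩ := exists_linearIndepOn_mem_hull t hx
      exact ⟨u, ⟨h1, h2⟩, h3⟩
    · rintro ⟨u, ⟨h1, -⟩, h3⟩
      exact Submodule.span_mono (Set.image_mono (Finset.coe_subset.mpr h1)) h3
  rw [this]
  exact isClosed_biUnion_finset fun u h => hu u (Finset.mem_filter.mp h).2

lemma exists_pos_add_smul_mem {s : Set V} {v : V} (hv : v ∈ interior s) (u : V) :
    ∃ ε : ℝ, 0 < ε ∧ v + ε • u ∈ s := by
  have hc : Filter.Tendsto (fun ε : ℝ => v + ε • u) (𝓝 0) (𝓝 v) := by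
    have : Continuous fun ε : ℝ => v + ε • u := by fun_prop
    simpa using this.tendsto 0
  have h := (hc.eventually (mem_interior_iff_mem_nhds.mp hv)).filter_mono
    (nhdsWithin_le_nhds (s := Set.Ioi 0))
  obtain ⟨ε, h1, h2⟩ := (h.and self_mem_nhdsWithin).exists
  exact ⟨ε, h2, h1⟩

/-- For `u ∈ σ` write `v = ε u + (v - ε u)` with both terms in `σ`: a face through `v` contains `u`.
-/
lemma memRelint_of_mem_interior {σ : PointedCone ℝ V} {v : V} (hv : v ∈ interior (σ : Set V)) :
    MemRelint σ v := by
  refine ⟨interior_subset hv, fun ρ hρ h => le_antisymm hρ.le fun u hu => ?_⟩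
  obtain ⟨ε, hε, hm⟩ := exists_pos_add_smul_mem hv (-u)
  exact hρ.mem_of_smul_add_mem hu hm hε (by simpa using h)

lemma span_eq_top_of_mem_interior {s : Set V} {v : V} (hv : v ∈ interior s) :
    Submodule.span ℝ s = ⊤ := by
  refine eq_top_iff.mpr fun u _ => ?_
  obtain ⟨ε, hε, hm⟩ := exists_pos_add_smul_mem hv u
  have h := (Submodule.span ℝ s).sub_mem (Submodule.subset_span hm)
    (Submodule.subset_span (interior_subset hv))
  rw [add_sub_cancel_left] at h
  exact (Submodule.smul_mem_iff _ hε.ne').mp h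

end TopologicalCones


/-! ### The real class space -/

section RealClasses

variable {X : Scheme.{0}} [IsIntegral X] [IsNoetherian X]

instance : IsModuleTopology ℝ (ClR X) := ⟨rfl⟩

instance : IsTopologicalAddGroup (ClR X) := IsModuleTopology.topologicalAddGroup ℝ (ClR X)

instance : ContinuousSMul ℝ (ClR X) := IsModuleTopology.toContinuousSMul ℝ (ClR X)

instance [Module.Finite ℤ (Cl X)] : Module.Finite ℝ (ClR X) :=
  inferInstanceAs (Module.Finite ℝ (ℝ ⊗[ℤ] Cl X))

instance [Module.Finite ℤ (Cl X)] : T2Space (ClR X) := by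
  let e : ClR X ≃ₗ[ℝ] (Fin (Module.finrank ℝ (ClR X)) → ℝ) :=
    (Module.finBasis ℝ (ClR X)).equivFun
  exact T2Space.of_injective_continuous e.injective
    (IsModuleTopology.continuous_of_linearMap e.toLinearMap)

variable (X) in
/-- The map `Cl(X) → Cl(X)_ℝ` as a homomorphism. -/
def toRealHom : Cl X →+ ClR X where
  toFun := toReal
  map_zero' := TensorProduct.tmul_zero (Cl X) (1 : ℝ)
  map_add' := TensorProduct.tmul_add (1 : ℝ)

lemma toReal_sum_nsmul {ι : Type*} (t : Finset ι) (n : ι → ℕ) (d : ι → Cl X) :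
    toReal (∑ i ∈ t, n i • d i) = ∑ i ∈ t, (n i : ℝ) • toReal (d i) := by
  change toRealHom X _ = ∑ i ∈ t, (n i : ℝ) • toRealHom X (d i)
  simp only [map_sum, map_nsmul, Nat.cast_smul_eq_nsmul]

lemma toReal_nsmul (n : ℕ) (c : Cl X) : toReal (n • c) = (n : ℝ) • toReal c := by
  change toRealHom X _ = (n : ℝ) • toRealHom X c
  rw [map_nsmul, Nat.cast_smul_eq_nsmul]

lemma span_range_toReal : Submodule.span ℝ (Set.range (toReal (X := X))) = ⊤ := by
  refine eq_top_iff.mpr fun v _ => ?_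
  induction v using TensorProduct.induction_on with
  | zero => exact zero_mem _
  | tmul a c =>
    have : (a ⊗ₜ[ℤ] c : ℝ ⊗[ℤ] Cl X) = a • ((1 : ℝ) ⊗ₜ[ℤ] c) := by
      rw [TensorProduct.smul_tmul', smul_eq_mul, mul_one]
    rw [this]
    exact Submodule.smul_mem _ _ (Submodule.subset_span ⟨c, rfl⟩)
  | add v w hv hw => exact Submodule.add_mem _ (hv trivial) (hw trivial)

/-- A linear relation with integral coefficients holds in a cone spanned by integral classes. -/
theorem exists_nsmul_eq_sum_of_toReal_mem_hull {ι : Type*}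
    (d : ι → Cl X) (t : Finset ι) {c : Cl X}
    (hc : toReal c ∈ PointedCone.hull ℝ ((fun i => toReal (d i)) '' (t : Set ι))) :
    ∃ k : ℕ, 0 < k ∧ ∃ n : ι → ℕ, k • c = ∑ i ∈ t, n i • d i := by
  classical
  -- With independent degrees the real coefficients `a` are unique, so any integral relation
  -- involving `c` must be proportional to them.
  obtain ⟨u, hut, hli, hu⟩ := exists_linearIndepOn_mem_hull t hc
  obtain ⟨a, ha, hsum⟩ := mem_hull_image_iff.mp hu
  rw [← Finset.sum_coe_sort u] at hsum
  have hli' : ∀ g : u → ℝ, ∑ i : u, g i • toReal (d i) = 0 → ∀ i, g i = 0 :=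
    Fintype.linearIndependent_iff.mp hli
  -- Since `ℝ` is flat over `ℤ`, independence over `ℤ` would persist in `Cl(X)_ℝ`, against `hsum`.
  have hdep : ¬ LinearIndependent ℤ (fun o : Option u => o.elim c fun i => d i) := by
    intro h
    have h' : LinearIndependent ℝ (fun o : Option u => toReal (o.elim c fun i => d i)) :=
      Module.Flat.linearIndependent_one_tmul (S := ℝ) h
    have := Fintype.linearIndependent_iff.mp h' (fun o => o.elim (-1) fun i => a i) (by
      rw [Fintype.sum_option]
      simp only [Option.elim_none, Option.elim_some]
      rw [hsum, neg_smul, one_smul, neg_add_cancel]) none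
    simp at this
  obtain ⟨g, hg, o, ho⟩ := Fintype.not_linearIndependent_iff.mp hdep
  rw [Fintype.sum_option] at hg
  simp only [Option.elim_none, Option.elim_some] at hg
  have hgR : ∀ i : u, (g none : ℝ) * a i + g (some i) = 0 := by
    refine hli' _ ?_
    have h := congrArg (toRealHom X) hg
    simp only [map_add, map_zsmul, map_sum, map_zero] at h
    simp_rw [add_smul, mul_smul]
    rw [Finset.sum_add_distrib, ← Finset.smul_sum, hsum]
    simp only [Int.cast_smul_eq_zsmul]
    exact h
  have hg0 : g none ≠ 0 := by
    intro h0
    cases o with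
    | none => exact ho h0
    | some i =>
      have := hgR i
      rw [h0, Int.cast_zero, zero_mul, zero_add] at this
      exact ho (by exact_mod_cast this)
  refine ⟨(g none).natAbs, Int.natAbs_pos.mpr hg0,
    fun i => if h : i ∈ u then (g (some ⟨i, h⟩)).natAbs else 0, ?_⟩
  rw [← Finset.sum_subset hut (fun i _ hi => by
    beta_reduce; rw [dif_neg hi, zero_nsmul]),
    ← Finset.sum_coe_sort u]
  simp only [Finset.coe_mem, dite_true, Subtype.coe_eta]
  simp_rw [← natCast_zsmul]
  -- By `hgR` the other coefficients are zero or have the sign opposite to that of `g none`, so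
  -- absolute values give a relation in `ℕ`.
  rcases lt_or_gt_of_ne hg0 with h | h
  · have h1 : ∀ i : u, ((g (some i)).natAbs : ℤ) = g (some i) := fun i => by
      refine Int.natAbs_of_nonneg ?_
      have h2 := hgR i
      have h3 : (g none : ℝ) ≤ 0 := by exact_mod_cast h.le
      have : (0 : ℝ) ≤ g (some i) := by nlinarith [ha i, mul_nonneg (neg_nonneg.mpr h3) (ha i)]
      exact_mod_cast this
    simp_rw [h1, Int.ofNat_natAbs_of_nonpos h.le]
    rw [neg_smul, neg_eq_iff_add_eq_zero, hg]
  · have h1 : ∀ i : u, ((g (some i)).natAbs : ℤ) = -g (some i) := fun i => by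
      refine Int.ofNat_natAbs_of_nonpos ?_
      have h2 := hgR i
      have h3 : (0 : ℝ) ≤ g none := by exact_mod_cast h.le
      have : (g (some i) : ℝ) ≤ 0 := by nlinarith [ha i, mul_nonneg h3 (ha i)]
      exact_mod_cast this
    simp_rw [h1, Int.natAbs_of_nonneg h.le, neg_smul]
    rw [Finset.sum_neg_distrib, eq_neg_iff_add_eq_zero, hg]

end RealClasses

/-! ### Fans -/

section Fans

variable {X : Scheme.{0}} [IsIntegral X] [IsNoetherian X] {F : Set (PointedCone ℝ (ClR X))}
  {σ τ : PointedCone ℝ (ClR X)} {v : ClR X}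

/-- The intersection with `σ` is a face of `τ` through `v`, hence all of `τ`. -/
lemma IsFan.le_of_memRelint (hF : IsFan F) (hτ : τ ∈ F) (hσ : σ ∈ F) (hv : MemRelint τ v)
    (hvσ : v ∈ σ) : τ ≤ σ :=
  (hv.2 _ (hF.inter_isFaceOf τ hτ σ hσ) ⟨hv.1, hvσ⟩) ▸ inf_le_right

/-- Take a minimal cone of `F` containing `v`; its faces are again in `F`. -/
lemma IsFan.exists_memRelint (hF : IsFan F) (hσ : σ ∈ F) (hv : v ∈ σ) :
    ∃ τ ∈ F, MemRelint τ v := by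
  obtain ⟨τ, ⟨hτ, hvτ⟩, hmin⟩ := (hF.finite.subset (Set.sep_subset F fun τ => v ∈ τ)).exists_minimal
    ⟨σ, hσ, hv⟩
  exact ⟨τ, hτ, hvτ, fun ρ hρ h =>
    le_antisymm hρ.le (hmin ⟨hF.face_mem τ hτ ρ hρ, h⟩ hρ.le)⟩

lemma IsUnionOfCones.le_of_memRelint (hF : IsFan F) {A : PointedCone ℝ (ClR X)}
    (hA : IsUnionOfCones F (A : Set (ClR X))) (hτ : τ ∈ F) (hv : MemRelint τ v) (hvA : v ∈ A) :
    τ ≤ A := by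
  obtain ⟨G, hG, hAG⟩ := hA
  obtain ⟨σ, hσ, hvσ⟩ := Set.mem_iUnion₂.mp (hAG ▸ hvA : v ∈ ⋃ σ ∈ G, (σ : Set (ClR X)))
  have h := hF.le_of_memRelint hτ (hG hσ) hv hvσ
  intro u hu
  have : u ∈ (A : Set (ClR X)) := hAG ▸ Set.mem_biUnion hσ (h hu)
  exact this

lemma IsFan.isClosed [Module.Finite ℤ (Cl X)] (hF : IsFan F) (hτ : τ ∈ F) :
    IsClosed (τ : Set (ClR X)) := by
  obtain ⟨s, rfl⟩ := hF.rational τ hτ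
  exact isClosed_hull_image _ _

lemma memRelint_toReal_sum_nsmul (s : Finset (Cl X)) {n : Cl X → ℕ} (hn : ∀ g ∈ s, 0 < n g) :
    MemRelint (PointedCone.hull ℝ (toReal '' (s : Set (Cl X)))) (toReal (∑ g ∈ s, n g • g)) := by
  rw [toReal_sum_nsmul]
  exact memRelint_hull_of_sum fun g hg => Nat.cast_pos.mpr (hn g hg)

lemma IsFan.exists_memRelint_toReal (hF : IsFan F) (hτ : τ ∈ F) :
    ∃ c : Cl X, MemRelint τ (toReal c) := by
  obtain ⟨s, rfl⟩ := hF.rational τ hτ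
  exact ⟨_, memRelint_toReal_sum_nsmul s (n := 1) fun _ _ => one_pos⟩

lemma IsFan.subset_closure_rays (hF : IsFan F) (hτ : τ ∈ F) :
    (τ : Set (ClR X)) ⊆
      closure {v | ∃ c : Cl X, MemRelint τ (toReal c) ∧ ∃ t : ℝ, 0 < t ∧ v = t • toReal c} := by
  obtain ⟨s, rfl⟩ := hF.rational τ hτ
  intro v hv
  obtain ⟨a, ha, rfl⟩ := mem_hull_image_iff.mp hv
  -- The summand `1 / n` makes the rational approximations of `a g` strictly positive, which puts
  -- the approximating points in the relative interior.
  have hlim : Filter.Tendsto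
      (fun n : ℕ => ∑ g ∈ s, ((⌊a g * n⌋₊ : ℝ) / n + 1 / n) • toReal g) Filter.atTop
      (𝓝 (∑ g ∈ s, a g • toReal g)) := by
    refine tendsto_finsetSum _ fun g _ => Filter.Tendsto.smul_const ?_ _
    simpa using ((tendsto_nat_floor_mul_div_atTop (ha g)).comp
      tendsto_natCast_atTop_atTop).add (tendsto_one_div_atTop_nhds_zero_nat (𝕜 := ℝ))
  refine mem_closure_of_tendsto hlim ?_
  filter_upwards [Filter.eventually_gt_atTop 0] with n hn
  refine ⟨_, memRelint_toReal_sum_nsmul s (n := fun g => ⌊a g * n⌋₊ + 1)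
    (fun _ _ => Nat.succ_pos _), (n : ℝ)⁻¹, by positivity, ?_⟩
  rw [toReal_sum_nsmul, Finset.smul_sum]
  refine Finset.sum_congr rfl fun g _ => ?_
  rw [smul_smul]
  push_cast
  congr 1
  ring

/-- In a fan whose support is a full-dimensional convex cone every cone lies in a full-dimensional
cone of the fan. -/
theorem IsFan.exists_le_span_eq_top [Module.Finite ℤ (Cl X)] (hF : IsFan F)
    {A : PointedCone ℝ (ClR X)} (hA : ⋃ σ ∈ F, (σ : Set (ClR X)) = A)
    (hspan : Submodule.span ℝ (A : Set (ClR X)) = ⊤) (hσ : σ ∈ F) :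
    ∃ τ ∈ F, Submodule.span ℝ (τ : Set (ClR X)) = ⊤ ∧ σ ≤ τ := by
  classical
  obtain ⟨c, hc⟩ := hF.exists_memRelint_toReal hσ
  set v := toReal c
  have hvA : v ∈ A := by
    have : v ∈ ⋃ σ ∈ F, (σ : Set (ClR X)) := Set.mem_biUnion hσ hc.1
    rwa [hA] at this
  -- Move from `v` in a direction `w` of the support that avoids the spans of all lower-dimensional
  -- cones. One cone contains `v + w / (n + 1)` for infinitely many `n`; being closed, it contains
  -- `v`, and its span contains `w`.
  obtain ⟨w, hwA, hw⟩ := exists_mem_forall_notMem_of_span_eq_top A hspan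
    ((hF.finite.toFinset.image fun τ : PointedCone ℝ (ClR X) =>
      Submodule.span ℝ (τ : Set (ClR X))).erase ⊤) (Finset.notMem_erase _ _)
  have hex : ∃ τ ∈ F, ∃ᶠ n : ℕ in Filter.atTop, v + (1 / ((n : ℝ) + 1)) • w ∈ τ := by
    by_contra! h
    obtain ⟨n, hn⟩ := ((Filter.eventually_all_finite hF.finite).mpr h).exists
    have hmem : v + (1 / ((n : ℝ) + 1)) • w ∈ (A : Set (ClR X)) :=
      add_mem hvA (A.smul_mem (by positivity) hwA)
    rw [← hA] at hmem
    obtain ⟨τ, hτ, hm⟩ := Set.mem_iUnion₂.mp hmem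
    exact hn τ hτ hm
  obtain ⟨τ, hτ, hfreq⟩ := hex
  have hvτ : v ∈ τ := by
    refine (hF.isClosed hτ).mem_of_frequently_of_tendsto hfreq ?_
    simpa using ((tendsto_one_div_add_atTop_nhds_zero_nat (𝕜 := ℝ)).smul_const w).const_add v
  refine ⟨τ, hτ, ?_, hF.le_of_memRelint hσ hτ hc hvτ⟩
  by_contra hne
  obtain ⟨n, hn⟩ := hfreq.exists
  refine hw (Submodule.span ℝ (τ : Set (ClR X))) (Finset.mem_erase.mpr ⟨hne,
    Finset.mem_image_of_mem _ (hF.finite.mem_toFinset.mpr hτ)⟩) ?_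
  have h := (Submodule.span ℝ (τ : Set (ClR X))).sub_mem (Submodule.subset_span hn)
    (Submodule.subset_span hvτ)
  rw [add_sub_cancel_left] at h
  exact (Submodule.smul_mem_iff _ (by positivity)).mp h

end Fans


/-! ### Homogeneous elements and semistability -/

section Grading

variable {X : Scheme.{0}} [IsIntegral X] [IsNoetherian X] {r : ℕ} {D : Fin r → WDiv X}

/-- The basis of `Cl(X)` given by the classes of `D₁, …, D_r`. -/
def IsClassBasis.basis (hD : IsClassBasis D) : Module.Basis (Fin r) ℤ (Cl X) :=
  Module.Basis.mk hD.1 hD.2.ge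

lemma IsClassBasis.finite (hD : IsClassBasis D) : Module.Finite ℤ (Cl X) :=
  Module.Finite.of_basis hD.basis

lemma cl_combo (a : Fin r → ℤ) : cl (combo D a) = ∑ i, a i • cl (D i) := by
  change QuotientAddGroup.mk' (principalDivisors X) (∑ i, a i • D i) = _
  rw [map_sum]
  exact Finset.sum_congr rfl fun i _ => map_zsmul (QuotientAddGroup.mk' _) _ _

lemma cl_combo_add (a b : Fin r → ℤ) :
    cl (combo D (a + b)) = cl (combo D a) + cl (combo D b) := by
  rw [combo_add]; rfl

lemma IsClassBasis.exists_cl_combo_eq (hD : IsClassBasis D) (c : Cl X) :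
    ∃ a, cl (combo D a) = c := by
  have hc : c ∈ Submodule.span ℤ (Set.range fun i => cl (D i)) := hD.2 ▸ Submodule.mem_top
  obtain ⟨a, ha⟩ := (Submodule.mem_span_range_iff_exists_fun ℤ).mp hc
  exact ⟨a, (cl_combo a).trans ha⟩

/-- The characters of the torus separate the classes. -/
lemma IsClassBasis.eq_of_charEval_eq (hD : IsClassBasis D) {c c' : Cl X}
    (h : ∀ t : Torus X, charEval c t = charEval c' t) : c = c' := by
  refine hD.basis.ext_elem fun i => ?_
  -- Any number of infinite order would do: `t` sends a class to `2` raised to its `i`-th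
  -- coordinate.
  let u : ℂˣ := Units.mk0 2 two_ne_zero
  let t : Torus X := (zpowersHom ℂˣ u).comp
    (AddMonoidHom.toMultiplicative (hD.basis.coord i).toAddMonoidHom)
  have ht : (2 : ℂ) ^ (hD.basis.repr c i) = 2 ^ (hD.basis.repr c' i) := by
    have := h t
    simpa [charEval, t, u] using this
  have ht' := congrArg norm ht
  rw [norm_zpow, norm_zpow, Complex.norm_ofNat] at ht'
  exact zpow_right_injective₀ (by norm_num) (by norm_num) ht'

variable [IsNormalScheme X] [X.Over (Spec (CommRingCat.of ℂ))]

lemma IsClassBasis.mem_homogeneousPart_iff (hD : IsClassBasis D) {c : Cl X} {f : Cox D} :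
    f ∈ homogeneousPart D c ↔ ∀ a, f.1.coeff a ≠ 0 → cl (combo D a) = c := by
  constructor
  · intro h a ha
    refine hD.eq_of_charEval_eq fun t => ?_
    have ht : charEval (cl (combo D a)) t • f.1.coeff a = charEval c t • f.1.coeff a :=
      congrArg (fun g : Cox D => g.1.coeff a) (h t)
    exact smul_left_injective ℂ ha ht
  · intro h t
    ext a
    change charEval (cl (combo D a)) t • f.1.coeff a = charEval c t • f.1.coeff a
    by_cases ha : f.1.coeff a = 0
    · rw [ha, smul_zero, smul_zero]
    · rw [h a ha]

lemma IsClassBasis.one_mem_homogeneousPart (hD : IsClassBasis D) :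
    (1 : Cox D) ∈ homogeneousPart D 0 := by
  classical
  refine hD.mem_homogeneousPart_iff.mpr fun a ha => ?_
  have h0 : a = 0 := by
    by_contra hne
    refine ha ?_
    change (1 : AddMonoidAlgebra X.functionField (Fin r → ℤ)).coeff a = 0
    rw [AddMonoidAlgebra.one_def, AddMonoidAlgebra.coeff_single, Finsupp.single_apply,
      if_neg (Ne.symm hne)]
  rw [h0, cl_combo]
  simp

lemma IsClassBasis.mul_mem_homogeneousPart (hD : IsClassBasis D) {c c' : Cl X} {f g : Cox D}
    (hf : f ∈ homogeneousPart D c) (hg : g ∈ homogeneousPart D c') :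
    f * g ∈ homogeneousPart D (c + c') := by
  classical
  rw [hD.mem_homogeneousPart_iff] at hf hg ⊢
  intro a ha
  have ha' : (f.1 * g.1).coeff a ≠ 0 := ha
  rw [AddMonoidAlgebra.coeff_mul] at ha'
  obtain ⟨b, hb, hb'⟩ := Finset.exists_ne_zero_of_sum_ne_zero ha'
  obtain ⟨b', hb1, hb2⟩ := Finset.exists_ne_zero_of_sum_ne_zero hb'
  have hab : b + b' = a := by
    by_contra hne
    exact hb2 (if_neg hne)
  rw [← hab, cl_combo_add, hf b (Finsupp.mem_support_iff.mp hb),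
    hg b' (Finsupp.mem_support_iff.mp hb1)]

lemma IsClassBasis.pow_mem_homogeneousPart (hD : IsClassBasis D) {c : Cl X} {f : Cox D}
    (hf : f ∈ homogeneousPart D c) (n : ℕ) : f ^ n ∈ homogeneousPart D (n • c) := by
  induction n with
  | zero => rw [pow_zero, zero_nsmul]; exact hD.one_mem_homogeneousPart
  | succ n ih => rw [pow_succ, succ_nsmul]; exact hD.mul_mem_homogeneousPart ih hf

lemma IsHomogeneousElt.mem_homogeneousPart_deg {ψ : Cox D} (hψ : IsHomogeneousElt ψ) :
    ψ ∈ homogeneousPart D (deg ψ) := by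
  rw [deg, dif_pos hψ.2]
  exact hψ.2.choose_spec

lemma IsClassBasis.prod_pow_mem_homogeneousPart (hD : IsClassBasis D) {T : Finset (Cox D)}
    (hT : ∀ ψ ∈ T, IsHomogeneousElt ψ) (n : Cox D → ℕ) :
    ∏ ψ ∈ T, ψ ^ n ψ ∈ homogeneousPart D (∑ ψ ∈ T, n ψ • deg ψ) := by
  classical
  induction T using Finset.induction_on with
  | empty => simpa using hD.one_mem_homogeneousPart
  | insert ψ T hψ ih =>
    rw [Finset.prod_insert hψ, Finset.sum_insert hψ]
    exact hD.mul_mem_homogeneousPart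
      (hD.pow_mem_homogeneousPart (hT ψ (Finset.mem_insert_self _ _)).mem_homogeneousPart_deg _)
      (ih fun φ hφ => hT φ (Finset.mem_insert_of_mem hφ))

/-- An element of degree `c` is a linear combination of monomials of degree `c` in the
generators. -/
theorem IsHomogeneousGenerating.homogeneousPart_subset_span (hD : IsClassBasis D)
    {S : Finset (Cox D)} (hS : IsHomogeneousGenerating S) (c : Cl X) :
    homogeneousPart D c ⊆ Submodule.span ℂ
      {m | ∃ n : Cox D → ℕ, ∑ ψ ∈ S, n ψ • deg ψ = c ∧ ∏ ψ ∈ S, ψ ^ n ψ = m} := by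
  classical
  set M := Submodule.span ℂ
    {m : Cox D | ∃ n : Cox D → ℕ, ∑ ψ ∈ S, n ψ • deg ψ = c ∧ ∏ ψ ∈ S, ψ ^ n ψ = m}
  have key : ∀ g : Cox D, ∃ h ∈ M, ∀ a,
      h.1.coeff a = if cl (combo D a) = c then g.1.coeff a else 0 := by
    intro g
    have hg : g ∈ Submodule.span ℂ (Submonoid.closure (S : Set (Cox D)) : Set (Cox D)) := by
      rw [← Algebra.adjoin_eq_span, hS.2]
      exact Submodule.mem_top
    induction hg using Submodule.span_induction with
    | mem g hg =>
      obtain ⟨n, -, rfl⟩ := Submonoid.mem_closure_finset.mp hg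
      have hm := hD.mem_homogeneousPart_iff.mp (hD.prod_pow_mem_homogeneousPart hS.1 n)
      by_cases hn : ∑ ψ ∈ S, n ψ • deg ψ = c
      · refine ⟨_, Submodule.subset_span ⟨n, hn, rfl⟩, fun a => ?_⟩
        split_ifs with h
        · rfl
        · by_contra h0
          exact h ((hm a h0).trans hn)
      · refine ⟨0, zero_mem _, fun a => ?_⟩
        split_ifs with h
        · by_contra h0
          exact hn ((hm a (Ne.symm h0)).symm.trans h)
        · rfl
    | zero => exact ⟨0, zero_mem _, fun a => (ite_self _).symm⟩
    | add g g' _ _ hg hg' =>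
      obtain ⟨h, hM, hh⟩ := hg
      obtain ⟨h', hM', hh'⟩ := hg'
      refine ⟨h + h', add_mem hM hM', fun a => ?_⟩
      change h.1.coeff a + h'.1.coeff a = if _ then g.1.coeff a + g'.1.coeff a else 0
      rw [hh, hh']
      split_ifs
      · rfl
      · exact add_zero 0
    | smul z g _ hg =>
      obtain ⟨h, hM, hh⟩ := hg
      refine ⟨z • h, M.smul_mem z hM, fun a => ?_⟩
      change z • h.1.coeff a = if _ then z • g.1.coeff a else 0
      rw [hh]
      split_ifs
      · rfl
      · exact smul_zero z
  intro f hf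
  obtain ⟨h, hM, hh⟩ := key f
  have : f = h := by
    ext a
    rw [hh]
    split_ifs with hc
    · rfl
    · by_contra h0
      exact hc (hD.mem_homogeneousPart_iff.mp hf a h0)
  rw [this]
  exact hM

/-! ### Semistability in terms of cones of degrees -/

lemma cone_mono {S T : Finset (Cox D)} (h : S ⊆ T) : cone S ≤ cone T :=
  Submodule.span_mono (Set.image_mono (Finset.coe_subset.mpr h))

/-- A point `x` is semistable with respect to `c` if and only if `c` lies in the cone of the degrees
of those generators that do not vanish at `x`. -/
theorem IsHomogeneousGenerating.mem_semistable_iff (hD : IsClassBasis D) {S : Finset (Cox D)}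
    (hS : IsHomogeneousGenerating S) {c : Cl X} {x : SpecCox D}
    [DecidablePred fun ψ : Cox D => ψ ∉ x.asIdeal] :
    x ∈ semistable D c ↔ toReal c ∈ cone (S.filter fun ψ => ψ ∉ x.asIdeal) := by
  constructor
  · rintro ⟨i, hi, f, hf, hfx⟩
    obtain ⟨n, hn, hnx⟩ : ∃ n : Cox D → ℕ, ∑ ψ ∈ S, n ψ • deg ψ = i • c ∧
        ∏ ψ ∈ S, ψ ^ n ψ ∉ x.asIdeal := by
      by_contra! h
      refine hfx (Submodule.span_le (p := x.asIdeal.restrictScalars ℂ).mpr ?_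
        (hS.homogeneousPart_subset_span hD (i • c) hf))
      rintro _ ⟨n, hn, rfl⟩
      exact h n hn
    have hi' : toReal (i • c) ∈ cone (S.filter fun ψ => ψ ∉ x.asIdeal) := by
      rw [← hn, toReal_sum_nsmul]
      refine Submodule.sum_mem _ fun ψ hψ => ?_
      rcases Nat.eq_zero_or_pos (n ψ) with h0 | h0
      · rw [h0, Nat.cast_zero, zero_smul]
        exact zero_mem _
      · refine PointedCone.smul_mem _ (Nat.cast_nonneg _) (PointedCone.subset_hull ⟨ψ, ?_, rfl⟩)
        refine Finset.mem_coe.mpr (Finset.mem_filter.mpr ⟨hψ, fun hx => hnx ?_⟩)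
        exact Ideal.mem_of_dvd _ (Finset.dvd_prod_of_mem _ hψ)
          (Ideal.pow_mem_of_mem _ hx _ h0)
    rw [toReal_nsmul] at hi'
    have h := PointedCone.smul_mem _ (inv_nonneg.mpr (Nat.cast_nonneg (α := ℝ) i)) hi'
    rwa [inv_smul_smul₀ (Nat.cast_ne_zero.mpr hi.ne')] at h
  · intro hc
    obtain ⟨k, hk, n, hn⟩ := exists_nsmul_eq_sum_of_toReal_mem_hull deg _ hc
    refine ⟨k, hk, _, hn ▸ hD.prod_pow_mem_homogeneousPart
      (fun ψ hψ => hS.1 ψ (Finset.mem_filter.mp hψ).1) n, fun hx => ?_⟩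
    obtain ⟨ψ, hψ, hψx⟩ := Ideal.IsPrime.prod_mem_iff.mp hx
    exact (Finset.mem_filter.mp hψ).2 (x.2.mem_of_pow_mem _ hψx)

/-- No generator vanishes at the generic point of `𝔛`. -/
lemma IsHomogeneousGenerating.bot_mem_semistable (hD : IsClassBasis D) {S : Finset (Cox D)}
    (hS : IsHomogeneousGenerating S) {c : Cl X} (hc : toReal c ∈ cone S) :
    (⟨⊥, Ideal.isPrime_bot⟩ : SpecCox D) ∈ semistable D c := by
  classical
  rw [hS.mem_semistable_iff hD, Finset.filter_true_of_mem fun ψ hψ => by simpa using (hS.1 ψ hψ).1]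
  exact hc

lemma IsHomogeneousGenerating.toReal_mem_cone (hD : IsClassBasis D) {S : Finset (Cox D)}
    (hS : IsHomogeneousGenerating S) {c : Cl X} {x : SpecCox D} (hx : x ∈ semistable D c) :
    toReal c ∈ cone S := by
  classical
  exact cone_mono (Finset.filter_subset _ _) ((hS.mem_semistable_iff hD).mp hx)

/-- The class of a prime divisor is the degree of a nonzero homogeneous element. -/
lemma IsClassBasis.exists_ne_zero_mem_homogeneousPart (hD : IsClassBasis D) (E : PrimeDivisor X) :
    ∃ f ∈ homogeneousPart D (cl (Finsupp.single E 1)), f ≠ 0 := by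
  classical
  obtain ⟨a, ha⟩ := hD.exists_cl_combo_eq (cl (Finsupp.single E 1))
  obtain ⟨f, hf0, hf⟩ := QuotientAddGroup.eq.mp ha
  have hfm : f ∈ H0 (combo D a) := by
    intro _ E'
    rw [← hf E', Finsupp.add_apply, Finsupp.neg_apply, neg_add_cancel_comm]
    exact Finsupp.single_nonneg.mpr zero_le_one E'
  have hcoeff : ∀ b, (AddMonoidAlgebra.single a f).coeff b = if a = b then f else 0 := fun b => by
    rw [AddMonoidAlgebra.coeff_single, Finsupp.single_apply]
  refine ⟨⟨AddMonoidAlgebra.single a f, fun b => ?_⟩, hD.mem_homogeneousPart_iff.mpr fun b hb => ?_,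
    fun h => hf0 ?_⟩
  · rw [hcoeff]
    split_ifs with h
    · exact h ▸ hfm
    · exact zero_mem _
  · have hb' : (AddMonoidAlgebra.single a f).coeff b ≠ 0 := hb
    rw [hcoeff] at hb'
    have hab : a = b := by
      by_contra hne
      exact hb' (if_neg hne)
    rw [← hab, ha]
  · have h' : (AddMonoidAlgebra.single a f).coeff a = 0 :=
      congrArg (fun g : Cox D => g.1.coeff a) h
    rwa [hcoeff, if_pos rfl] at h'

/-- The degrees of the generators span `Cl(X)_ℝ`, as every prime divisor is effective. -/
theorem IsHomogeneousGenerating.span_cone_eq_top (hD : IsClassBasis D) {S : Finset (Cox D)}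
    (hS : IsHomogeneousGenerating S) : Submodule.span ℝ (cone S : Set (ClR X)) = ⊤ := by
  rw [eq_top_iff, ← span_range_toReal, Submodule.span_le]
  rintro _ ⟨c, rfl⟩
  obtain ⟨W, rfl⟩ := QuotientAddGroup.mk_surjective c
  change ((toRealHom X).comp (QuotientAddGroup.mk' _)) W ∈ Submodule.span ℝ (cone S : Set (ClR X))
  induction W using Finsupp.induction_linear with
  | zero => rw [map_zero]; exact zero_mem _
  | add W W' h h' => rw [map_add]; exact add_mem h h'
  | single E n =>
    rw [← smul_eq_mul n 1 |>.trans (mul_one n), ← Finsupp.smul_single, map_zsmul]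
    refine zsmul_mem (Submodule.subset_span ?_) n
    obtain ⟨f, hf, hf0⟩ := hD.exists_ne_zero_mem_homogeneousPart E
    exact hS.toReal_mem_cone hD (x := ⟨⊥, Ideal.isPrime_bot⟩)
      ⟨1, one_pos, f, by rwa [one_nsmul], by simpa using hf0⟩

end Grading

/-! ### The GIT fan -/

section GIT

variable {X : Scheme.{0}} [IsIntegral X] [IsNoetherian X] [IsNormalScheme X]
  [X.Over (Spec (CommRingCat.of ℂ))] {r : ℕ} {D : Fin r → WDiv X}
  {S : Finset (Cox D)} {F : Set (PointedCone ℝ (ClR X))} {τ : PointedCone ℝ (ClR X)}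

/-- The semistable locus is constant on the relative interior of a cone of the fan. -/
theorem SubdividesCones.semistable_eq (hF : SubdividesCones S F) (hD : IsClassBasis D)
    (hS : IsHomogeneousGenerating S) (hτ : τ ∈ F) {c c' : Cl X} (hc : MemRelint τ (toReal c))
    (hc' : MemRelint τ (toReal c')) : semistable D c = semistable D c' := by
  classical
  ext x
  have h := hF.subdivides (S.filter fun ψ => ψ ∉ x.asIdeal) (Finset.filter_subset _ _)
  rw [hS.mem_semistable_iff hD, hS.mem_semistable_iff hD]
  exact ⟨fun h1 => h.le_of_memRelint hF.isFan hτ hc h1 hc'.1,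
    fun h1 => h.le_of_memRelint hF.isFan hτ hc' h1 hc.1⟩

lemma SubdividesCones.subset_closure_gitClass (hF : SubdividesCones S F) (hD : IsClassBasis D)
    (hS : IsHomogeneousGenerating S) (hτ : τ ∈ F) {c : Cl X} (hc : MemRelint τ (toReal c)) :
    (τ : Set (ClR X)) ⊆ closure (gitClass D c) := by
  refine (hF.isFan.subset_closure_rays hτ).trans (closure_mono ?_)
  rintro v ⟨c', hc', t, ht, rfl⟩
  exact ⟨c', hF.semistable_eq hD hS hτ hc' hc, t, ht, rfl⟩

lemma SubdividesCones.mem_cone (hF : SubdividesCones S F) (hτ : τ ∈ F) {v : ClR X} (hv : v ∈ τ) :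
    v ∈ cone S := by
  have h : v ∈ ⋃ σ ∈ F, (σ : Set (ClR X)) := Set.mem_biUnion hτ hv
  rwa [hF.support] at h

theorem SubdividesCones.refinesGITFan (hF : SubdividesCones S F) (hD : IsClassBasis D)
    (hS : IsHomogeneousGenerating S) : RefinesGITFan D F := by
  have := hD.finite
  refine ⟨fun σ hσ => ?_, ?_⟩
  · obtain ⟨τ, hτ, hspan, hστ⟩ :=
      hF.isFan.exists_le_span_eq_top hF.support (hS.span_cone_eq_top hD) hσ
    obtain ⟨c, hc⟩ := hF.isFan.exists_memRelint_toReal hτ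
    have hsub := hF.subset_closure_gitClass hD hS hτ hc
    refine ⟨gitClass D c, ⟨⟨c, ⟨_, hS.bot_mem_semistable hD (hF.mem_cone hτ hc.1)⟩, rfl⟩, ?_⟩,
      fun v hv => hsub (hστ hv)⟩
    -- The span of the class is closed, so it contains the closure and with it `τ`.
    rw [eq_top_iff, ← hspan, Submodule.span_le]
    exact hsub.trans (closure_minimal Submodule.subset_span
      (Submodule.closed_of_finiteDimensional _))
  · rintro _ ⟨c, ⟨x, hx⟩, rfl⟩
    refine ⟨{τ | τ ∈ F ∧ ∃ c', MemRelint τ (toReal c') ∧ semistable D c' = semistable D c},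
      fun τ h => h.1, Set.Subset.antisymm (closure_minimal ?_ ?_) ?_⟩
    · rintro _ ⟨c', hc', t, ht, rfl⟩
      have hmem : toReal c' ∈ ⋃ σ ∈ F, (σ : Set (ClR X)) := by
        rw [hF.support]
        exact hS.toReal_mem_cone hD (hc' ▸ hx)
      obtain ⟨σ, hσ, hcσ⟩ := Set.mem_iUnion₂.mp hmem
      obtain ⟨τ, hτ, hcτ⟩ := hF.isFan.exists_memRelint hσ hcσ
      exact Set.mem_biUnion (x := τ) ⟨hτ, c', hcτ, hc'⟩ (τ.smul_mem ht.le hcτ.1)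
    · exact (hF.isFan.finite.subset fun τ h => h.1).isClosed_biUnion
        fun τ h => hF.isFan.isClosed h.1
    · refine Set.iUnion₂_subset fun τ h => ?_
      obtain ⟨hτ, c', hc', heq⟩ := h
      have hcls : gitClass D c' = gitClass D c := by simp only [gitClass, heq]
      exact hcls ▸ hF.subset_closure_gitClass hD hS hτ hc'

theorem SubdividesCones.compl_semistable (hF : SubdividesCones S F) (hD : IsClassBasis D)
    (hS : IsHomogeneousGenerating S) {C : Set (ClR X)} (hC : IsChamber F C) {c : Cl X}
    (hc : toReal c ∈ C) :
    (semistable D c)ᶜ =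
      ⋂ S' ∈ {S' : Finset (Cox D) | S' ⊆ S ∧ S'.card = Module.finrank ℝ (ClR X) ∧
        toReal c ∈ cone S'}, zeroLocusProd S' := by
  classical
  obtain ⟨-, σ, hσ, rfl⟩ := hC
  ext x
  rw [Set.mem_compl_iff, hS.mem_semistable_iff hD, Set.mem_iInter₂]
  constructor
  · rintro h S' ⟨hS', -, hcS'⟩
    by_contra hx
    refine h (cone_mono (fun ψ hψ => ?_) hcS')
    rw [Finset.mem_filter]
    refine ⟨hS' hψ, fun hψx => hx ?_⟩
    exact (PrimeSpectrum.mem_zeroLocus x _).mpr (Set.singleton_subset_iff.mpr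
      (Ideal.mem_of_dvd _ (Finset.dvd_prod_of_mem (fun ψ => ψ) hψ) hψx))
  · intro h hcone
    obtain ⟨u, hu, hli, hcu⟩ := exists_linearIndepOn_mem_hull _ hcone
    have huS : u ⊆ S := hu.trans (Finset.filter_subset _ _)
    have hσu : σ ≤ cone u := (hF.subdivides u huS).le_of_memRelint hF.isFan hσ
      (memRelint_of_mem_interior hc) hcu
    -- The cone `σ` has interior points and lies in `cone u`, so the degrees of `u` form a basis.
    have hspan : Submodule.span ℝ (Set.range fun ψ : u => toReal (deg (ψ : Cox D))) = ⊤ := by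
      rw [eq_top_iff, ← span_eq_top_of_mem_interior hc, Submodule.span_le]
      refine fun v hv => PointedCone.hull_le_span ℝ _ ?_
      have := hσu hv
      rwa [cone, Set.image_eq_range] at this
    have hcard : u.card = Module.finrank ℝ (ClR X) := by
      have h1 := finrank_span_eq_card hli
      rw [← finrank_top ℝ (ClR X), ← hspan]
      exact (h1.trans (Fintype.card_coe u)).symm
    have hx := (PrimeSpectrum.mem_zeroLocus x _).mp (h u ⟨huS, hcard, hcu⟩) rfl
    obtain ⟨ψ, hψ, hψx⟩ := Ideal.IsPrime.prod_mem_iff.mp hx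
    exact (Finset.mem_filter.mp (hu hψ)).2 hψx

end GIT

end CoxGIT

end

theorem proposition5p2 (X : Scheme.{0}) [IsIntegral X] [IsNoetherian X] [IsNormalScheme X]
    [X.Over (Spec (CommRingCat.of ℂ))] {r : ℕ} (D : Fin r → WDiv X) (hD : IsClassBasis D)
    (S : Finset (Cox D)) (hS : IsHomogeneousGenerating S)
    (F : Set (PointedCone ℝ (ClR X))) (hF : IsCoarsestFan S F) :
    (∀ C : Set (ClR X), IsChamber F C → ∀ c : Cl X, toReal c ∈ C →
      (semistable D c)ᶜ =
        ⋂ S' ∈ {S' : Finset (Cox D) | S' ⊆ S ∧ S'.card = Module.finrank ℝ (ClR X) ∧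
          toReal c ∈ cone S'}, zeroLocusProd S') ∧
    RefinesGITFan D F := by
  exact ⟨fun _ hC _ hc => hF.subdividesCones.compl_semistable hD hS hC hc,
    hF.subdividesCones.refinesGITFan hD hS⟩
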